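/- **Corollary 3.3.** *Relation algebras.* A relation algebra $\mathcal A=(A,0,1,+,-,1',\breve{\ },;)$ is a boolean algebra with an involuted monoid $(A,1',\breve{\ },;)$ (so $;$ is associative with identity $1'$, $a^{\smile\smile}=a$ and $(a;b)^\smile=b^\smile;a^\smile$) such that $\breve{\ }$ and $;$ are normal and additive in each argument and $a^\smile;(-(a;b))\le -b$ for all $a,b$. A representation of $\mathcal A$ is an embedding of $\mathcal A$ into the algebra of all subsets of some equivalence relation $E$ on a set $X$ (with union, complement in $E$, the identity relation on $X$, converse and composition of relations). It is complete if it sends every supremum that exists in $\mathcal A$ to a union. $\mathcal A$ is (completely) representable if it has a (complete) representation. *Atom structures.* The atom structure of an atomic relation algebra is the relational structure whose domain is the set of atoms, with a unary relation $\{a: a\le 1'\}$, a binary relation $\{(a,a^\smile)\}$ and a ternary relation $\{(a,b,c): c\le a;b\}$ (the consistent triples). The language of RA atom structures is first-order logic with equality over these three relation symbols; its variables range over atoms and may be re-used. Structures isomorphic to atom structures are counted as atom structures. *Claim.* Let $\mathcal K$ be a class of RA atom structures that contains all atom structures of completely representable relation algebras and is contained in the class of atom structures of representable atomic relation algebras.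 Then there is no set $\Theta$ (finite or infinite) of sentences in the language of RA atom structures such that only finitely many variables occur in $\Theta$ altogether and such that, for all RA atom structures $M$ with nonempty domain, $M\in\mathcal K$ if and only if $M\models\Theta$. *Witnesses.* For sets $S,T$ let $\mathrm{At}(\mathcal B_{S,T})$ be the structure with elements $1',\mathbf b,\mathbf w,\mathbf y$, $\mathbf g_i$ ($i\in S$) and $\mathbf r_{j,j'}$ ($j,j'\in T$), where only $1'$ is below the identity, $\mathbf r_{j,j'}^\smile=\mathbf r_{j',j}$, all other elements are self-converse, and the consistent triples are all triples except the Peircean transforms $(a,b,c)$, $(a^\smile,c,b)$, $(c,b^\smile,a)$, $(b,c^\smile,a^\smile)$, $(c^\smile,a,b^\smile)$, $(b^\smile,a^\smile,c^\smile)$ of the following triples $(a,b,c)$: $(1',a,b)$ with $a\ne b$; $(\mathbf g_i,\mathbf g_{i'},\mathbf g_{i''})$ and $(\mathbf g_i,\mathbf g_{i'},\mathbf w)$; $(\mathbf y,\mathbf y,\mathbf y)$ and $(\mathbf y,\mathbf y,\mathbf b)$; $(\mathbf r_{j_1,j_2},\mathbf r_{j_2',j_3},\mathbf r_{j_1^*,j_3^*})$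 unless $j_1=j_1^*$, $j_2=j_2'$ and $j_3=j_3^*$; $(\mathbf g_i,\mathbf g_i,\mathbf r_{j,j'})$ and $(\mathbf g_i,\mathbf g_{i'},\mathbf r_{j,j})$. Then for all finite sets $S,T$ with $2\le|S|<|T|$: $\mathrm{At}(\mathcal B_{S,S})\in\mathcal K$; $\mathrm{At}(\mathcal B_{T,S})$ is an RA atom structure that is not in $\mathcal K$; and the second player $\exists$ has a winning strategy in the Ehrenfeucht–Fraïssé game with $|S|$ pebbles and $\omega$ rounds on $\mathrm{At}(\mathcal B_{S,S})$ and $\mathrm{At}(\mathcal B_{T,S})$. (In each round $\forall$ places one of the pebbles, possibly one already on the board, on an element of one of the structures, and $\exists$ places its partner on an element of the other; $\exists$ wins if after every round the pebbled pairs form an isomorphism of the induced substructures.) -/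

import Mathlib

universe u

/-- Relation algebras: a boolean algebra with an involuted monoid `(ident, conv, comp)` whose
operations are normal operators (additive and `⊥`-preserving in each argument) that satisfy the
Peircean law. -/
class RelationAlgebra (A : Type u) extends BooleanAlgebra A where
  /-- the identity element `1'` -/
  ident : A
  /-- the converse operation -/
  conv : A → A
  /-- the composition `a ; b` -/
  comp : A → A → A
  comp_assoc : ∀ a b c : A, comp (comp a b) c = comp a (comp b c)
  ident_comp : ∀ a : A, comp ident a = a
  comp_ident : ∀ a : A, comp a ident = a
  conv_conv : ∀ a : A, conv (conv a) = a
  conv_comp : ∀ a b : A, conv (comp a b) = comp (conv b) (conv a)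
  conv_bot : conv ⊥ = ⊥
  conv_sup : ∀ a b : A, conv (a ⊔ b) = conv a ⊔ conv b
  bot_comp : ∀ a : A, comp ⊥ a = ⊥
  comp_bot : ∀ a : A, comp a ⊥ = ⊥
  sup_comp : ∀ a b c : A, comp (a ⊔ b) c = comp a c ⊔ comp b c
  comp_sup : ∀ a b c : A, comp a (b ⊔ c) = comp a b ⊔ comp a c
  peircean : ∀ a b : A, comp (conv a) (comp a b)ᶜ ≤ bᶜ

namespace RelationAlgebra

/-- A representation of `A` over the base `X`: an embedding of `A` into the proper relation algebra
of all subsets of an equivalence relation on `X`. (Every `θ a` is contained in the equivalence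
relation, by `map_top` and `map_sup`.) -/
structure Representation (A : Type u) [RelationAlgebra A] (X : Type u) where
  unit : Setoid X
  θ : A → SetRel X X
  injective : Function.Injective θ
  map_bot : θ ⊥ = ∅
  map_top : θ ⊤ = {p | unit p.1 p.2}
  map_sup : ∀ a b, θ (a ⊔ b) = θ a ∪ θ b
  map_compl : ∀ a, θ aᶜ = {p | unit p.1 p.2} \ θ a
  map_ident : θ ident = {p | p.1 = p.2}
  map_conv : ∀ a, θ (conv a) = {p | (p.2, p.1) ∈ θ a}
  map_comp : ∀ a b, θ (comp a b) = {p | ∃ z, (p.1, z) ∈ θ a ∧ (z, p.2) ∈ θ b}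

/-- A representation is complete if it preserves every supremum that exists in `A`. -/
def Representation.IsComplete {A : Type u} [RelationAlgebra A] {X : Type u}
    (r : Representation A X) : Prop :=
  ∀ (s : Set A) (a : A), IsLUB s a → r.θ a = ⋃ b ∈ s, r.θ b

def Representable (A : Type u) [RelationAlgebra A] : Prop :=
  ∃ X : Type u, Nonempty (Representation A X)

def CompletelyRepresentable (A : Type u) [RelationAlgebra A] : Prop :=
  ∃ (X : Type u) (r : Representation A X), r.IsComplete

end RelationAlgebra

/-- Structures for the relational language of atom structures: a unary relation (being below the
identity), a binary relation (the graph of converse) and a ternary relation (the consistent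
triples). -/
structure AtomStructure : Type (u + 1) where
  carrier : Type u
  isId : carrier → Prop
  conv : carrier → carrier → Prop
  consistent : carrier → carrier → carrier → Prop

namespace AtomStructure

/-- Isomorphisms of atom structures. -/
structure Iso (M N : AtomStructure.{u}) extends M.carrier ≃ N.carrier where
  map_isId : ∀ a, N.isId (toFun a) ↔ M.isId a
  map_conv : ∀ a b, N.conv (toFun a) (toFun b) ↔ M.conv a b
  map_consistent : ∀ a b c,
    N.consistent (toFun a) (toFun b) (toFun c) ↔ M.consistent a b c

open RelationAlgebra in
/-- The atom structure of a relation algebra: its atoms `a`, those with `a ≤ 1'`, the pairs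
`(a, conv a)`, and the triples `(a, b, c)` with `c ≤ a ; b`. -/
def ofRA (A : Type u) [RelationAlgebra A] : AtomStructure.{u} where
  carrier := {a : A // IsAtom a}
  isId a := a.1 ≤ ident
  conv a b := b.1 = RelationAlgebra.conv a.1
  consistent a b c := c.1 ≤ comp a.1 b.1

/-- The class of (structures isomorphic to) atom structures of atomic relation algebras. -/
def atRA : Set AtomStructure.{u} :=
  {M | ∃ (A : Type u) (_ : RelationAlgebra A), IsAtomic A ∧ Nonempty (M.Iso (ofRA A))}

/-- The class of atom structures of representable atomic relation algebras. -/
def atRRA : Set AtomStructure.{u} :=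
  {M | ∃ (A : Type u) (_ : RelationAlgebra A), IsAtomic A ∧ RelationAlgebra.Representable A ∧
    Nonempty (M.Iso (ofRA A))}

/-- The class of atom structures of completely representable (atomic) relation algebras. -/
def atCRA : Set AtomStructure.{u} :=
  {M | ∃ (A : Type u) (_ : RelationAlgebra A), IsAtomic A ∧
    RelationAlgebra.CompletelyRepresentable A ∧ Nonempty (M.Iso (ofRA A))}

/-- First-order formulas (with equality) in the language of atom structures. The variables are
`0, 1, 2, …` and may be quantified again inside the scope of a quantifier over them. -/
inductive Formula : Type
  | falsum : Formula
  | equal (x y : ℕ) : Formula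
  | isId (x : ℕ) : Formula
  | conv (x y : ℕ) : Formula
  | consistent (x y z : ℕ) : Formula
  | imp (φ ψ : Formula) : Formula
  | all (x : ℕ) (φ : Formula) : Formula

namespace Formula

/-- All variables that occur in a formula, free, bound or in a quantifier. -/
def vars : Formula → Finset ℕ
  | falsum => ∅
  | equal x y => {x, y}
  | isId x => {x}
  | conv x y => {x, y}
  | consistent x y z => {x, y, z}
  | imp φ ψ => φ.vars ∪ ψ.vars
  | all x φ => insert x φ.vars

def freeVars : Formula → Finset ℕ
  | falsum => ∅
  | equal x y => {x, y}
  | isId x => {x}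
  | conv x y => {x, y}
  | consistent x y z => {x, y, z}
  | imp φ ψ => φ.freeVars ∪ ψ.freeVars
  | all x φ => φ.freeVars.erase x

def IsSentence (φ : Formula) : Prop := φ.freeVars = ∅

/-- Tarskian satisfaction under an assignment of atoms to the variables. -/
def Sat (M : AtomStructure.{u}) : Formula → (ℕ → M.carrier) → Prop
  | falsum, _ => False
  | equal x y, v => v x = v y
  | isId x, v => M.isId (v x)
  | conv x y, v => M.conv (v x) (v y)
  | consistent x y z, v => M.consistent (v x) (v y) (v z)
  | imp φ ψ, v => Sat M φ v → Sat M ψ v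
  | all x φ, v => ∀ a : M.carrier, Sat M φ (Function.update v x a)

end Formula

/-- `M` is a model of the theory `Θ`. For a sentence over a nonempty `M`, truth under all
assignments is the same as truth under one. -/
def Models (M : AtomStructure.{u}) (Θ : Set Formula) : Prop :=
  ∀ φ ∈ Θ, ∀ v : ℕ → M.carrier, φ.Sat M v

/-- The theory `Θ` uses only finitely many variables altogether. -/
def UsesFinitelyManyVariables (Θ : Set Formula) : Prop :=
  ∃ V : Finset ℕ, ∀ φ ∈ Θ, φ.vars ⊆ V

/-- `Θ` defines the class `K` among atom structures of relation algebras. Only structures with a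
nonempty domain are looked at, as usual in first-order logic; this leaves out nothing but the empty
atom structure of the one-element algebra, and makes definability easier to achieve. -/
def Defines (Θ : Set Formula) (K : Set AtomStructure.{u}) : Prop :=
  ∀ M ∈ atRA.{u}, Nonempty M.carrier → (M ∈ K ↔ M.Models Θ)

end AtomStructure

/-- The atoms of the rainbow algebra with green atoms indexed by `S` and red atoms by `T × T`. -/
inductive RainbowAtom (S T : Type u) : Type u
  | ident : RainbowAtom S T
  | black : RainbowAtom S T
  | white : RainbowAtom S T
  | yellow : RainbowAtom S T
  | green (i : S) : RainbowAtom S T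
  | red (j j' : T) : RainbowAtom S T

namespace RainbowAtom

variable {S T : Type u}

def conv : RainbowAtom S T → RainbowAtom S T
  | red j j' => red j' j
  | a => a

/-- The forbidden triples before closing under Peircean transforms. -/
inductive BasicForbidden : RainbowAtom S T → RainbowAtom S T → RainbowAtom S T → Prop
  | ident (a b) (h : a ≠ b) : BasicForbidden ident a b
  | ggg (i i' i'') : BasicForbidden (green i) (green i') (green i'')
  | ggw (i i') : BasicForbidden (green i) (green i') white
  | yyy : BasicForbidden yellow yellow yellow
  | yyb : BasicForbidden yellow yellow black
  | rrr (j₁ j₂ j₂' j₃ j₁' j₃') (h : ¬ (j₁ = j₁' ∧ j₂ = j₂' ∧ j₃ = j₃')) :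
      BasicForbidden (red j₁ j₂) (red j₂' j₃) (red j₁' j₃')
  | ggr_green (i j j') : BasicForbidden (green i) (green i) (red j j')
  | ggr_red (i i' j) : BasicForbidden (green i) (green i') (red j j)

/-- The forbidden triples: the six Peircean transforms of the basic ones. -/
inductive Forbidden : RainbowAtom S T → RainbowAtom S T → RainbowAtom S T → Prop
  | t₁ {a b c} (h : BasicForbidden a b c) : Forbidden a b c
  | t₂ {a b c} (h : BasicForbidden a b c) : Forbidden a.conv c b
  | t₃ {a b c} (h : BasicForbidden a b c) : Forbidden c b.conv a
  | t₄ {a b c} (h : BasicForbidden a b c) : Forbidden b c.conv a.conv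
  | t₅ {a b c} (h : BasicForbidden a b c) : Forbidden c.conv a b.conv
  | t₆ {a b c} (h : BasicForbidden a b c) : Forbidden b.conv a.conv c.conv

end RainbowAtom

/-- The atom structure of the rainbow algebra `𝓑_{S,T}`. -/
def rainbow (S T : Type u) : AtomStructure.{u} where
  carrier := RainbowAtom S T
  isId a := a = RainbowAtom.ident
  conv a b := b = a.conv
  consistent a b c := ¬ RainbowAtom.Forbidden a b c

/-! The Ehrenfeucht–Fraïssé game with `k` pebbles and `ω` rounds on two atom structures. -/

namespace PebbleGame

variable {k : ℕ} {M N : AtomStructure.{u}}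

/-- In a position each pebble either is off the board or marks a pair of atoms. -/
abbrev Position (k : ℕ) (M N : AtomStructure.{u}) : Type u :=
  Fin k → Option (M.carrier × N.carrier)

/-- The first player chooses a pebble and an element of one of the two structures. -/
abbrev Move (k : ℕ) (M N : AtomStructure.{u}) : Type u :=
  Fin k × (M.carrier ⊕ N.carrier)

/-- The pebbled pairs form (the graph of) an isomorphism of the induced substructures. -/
def Position.IsPartialIso (p : Position k M N) : Prop :=
  (∀ i a b, p i = some (a, b) → (M.isId a ↔ N.isId b)) ∧
  (∀ i a b i' a' b', p i = some (a, b) → p i' = some (a', b') →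
    ((a = a' ↔ b = b') ∧ (M.conv a a' ↔ N.conv b b'))) ∧
  (∀ i a b i' a' b' i'' a'' b'', p i = some (a, b) → p i' = some (a', b') →
    p i'' = some (a'', b'') → (M.consistent a a' a'' ↔ N.consistent b b' b''))

/-- A strategy of the second player: an answer in the other structure to every next move, given
the moves of the first player so far (the latest first). -/
structure Strategy (k : ℕ) (M N : AtomStructure.{u}) where
  answerRight : List (Move k M N) → Fin k → M.carrier → N.carrier
  answerLeft : List (Move k M N) → Fin k → N.carrier → M.carrier

/-- The position after the given moves of the first player (the latest first), when the second
player follows the strategy. A pebble that is played again leaves its old place. -/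
def Strategy.position (σ : Strategy k M N) : List (Move k M N) → Position k M N
  | [] => fun _ => none
  | (i, Sum.inl a) :: h => Function.update (σ.position h) i (some (a, σ.answerRight h i a))
  | (i, Sum.inr b) :: h => Function.update (σ.position h) i (some (σ.answerLeft h i b, b))

/-- The second player has a strategy with which she never loses, at any finite stage. -/
def SecondPlayerWins (k : ℕ) (M N : AtomStructure.{u}) : Prop :=
  ∃ σ : Strategy k M N, ∀ h : List (Move k M N), (σ.position h).IsPartialIso

end PebbleGame

/-! ### Consistent triples of rainbow atoms -/

namespace RainbowAtom

variable {S T : Type u}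

/-! The rainbow algebra hides a pigeonhole problem. Over a black edge, take for each green index a
point that sees one end of the edge in green and the other in yellow. Green-green and yellow-yellow
triangles leave only red labels, with two distinct indices, between points of different green. The
rule for red triangles then makes each label `red (f u) (f v)` for one function `f` on the points
(`exists_index`), and `f` is injective. So a representation maps green indices injectively to red
indices (`card_le_of_mem_atRRA`), and `rainbow T S` with more greens than reds is not representable.

If greens and reds have the same finite index set, this obstruction vanishes: when a green is still
missing from such a cone, a red index is missing too (`exists_reds`). Any required witness can
therefore be added to a consistent network (`exists_extension`), and the limit of finite networks is
a complete representation (`completelyRepresentable_complexAlgebra`).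

The atom structure, however, sees green indices only through equality. With the same reds on both
sides, corresponding greens need only form a partial bijection, which `k` pebbles or variables can
always maintain among at least `k` greens (`secondPlayerWins`, `sat_iff`). A theory in finitely many
variables thus fails to separate two rainbow structures that `K` must separate. -/

@[simp] theorem conv_conv (a : RainbowAtom S T) : a.conv.conv = a := by cases a <;> rfl

@[simp] theorem conv_ident : (ident : RainbowAtom S T).conv = ident := rfl

@[simp] theorem conv_white : (white : RainbowAtom S T).conv = white := rfl

@[simp] theorem conv_black : (black : RainbowAtom S T).conv = black := rfl

@[simp] theorem conv_yellow : (yellow : RainbowAtom S T).conv = yellow := rfl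

@[simp] theorem conv_green (i : S) : (green i : RainbowAtom S T).conv = green i := rfl

@[simp] theorem conv_red (j j' : T) : (red j j' : RainbowAtom S T).conv = red j' j := rfl

instance [Finite S] [Finite T] : Finite (RainbowAtom S T) := by
  let g : RainbowAtom S T → Option (Option (Option (Option (S ⊕ T × T)))) := fun
    | ident => none
    | black => some none
    | white => some (some none)
    | yellow => some (some (some none))
    | green i => some (some (some (some (.inl i))))
    | red j j' => some (some (some (some (.inr (j, j')))))
  refine Finite.of_injective g fun a b hab => ?_
  cases a <;> cases b <;> simp_all [g]

theorem conv_eq_iff {a b : RainbowAtom S T} : a.conv = b ↔ a = b.conv :=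
  ⟨fun h => by rw [← h, conv_conv], fun h => by rw [h, conv_conv]⟩

@[simp] theorem conv_eq_ident {a : RainbowAtom S T} : a.conv = ident ↔ a = ident := by
  rw [conv_eq_iff, conv_ident]

/-- The basic forbidden triples, by recursion on the colours. -/
def basicForbidden : RainbowAtom S T → RainbowAtom S T → RainbowAtom S T → Prop
  | ident, a, b => a ≠ b
  | green _, green _, green _ => True
  | green _, green _, white => True
  | green i, green i', red j j' => i = i' ∨ j = j'
  | yellow, yellow, yellow => True
  | yellow, yellow, black => True
  | red j₁ j₂, red j₂' j₃, red j₁' j₃' => ¬ (j₁ = j₁' ∧ j₂ = j₂' ∧ j₃ = j₃')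
  | _, _, _ => False

theorem basicForbidden_iff {a b c : RainbowAtom S T} :
    BasicForbidden a b c ↔ basicForbidden a b c := by
  constructor
  · rintro (h | _ | _ | _ | _ | h | _ | _) <;> simp_all [basicForbidden]
  · intro h
    unfold basicForbidden at h
    split at h
    · exact .ident _ _ h
    · exact .ggg _ _ _
    · exact .ggw _ _
    · rcases h with rfl | rfl
      · exact .ggr_green _ _ _
      · exact .ggr_red _ _ _
    · exact .yyy
    · exact .yyb
    · exact .rrr _ _ _ _ _ _ h
    · exact h.elim

/-- The consistent triples of a rainbow atom structure. -/
def Consistent (a b c : RainbowAtom S T) : Prop := ¬ Forbidden a b c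

theorem forbidden_iff {a b c : RainbowAtom S T} :
    Forbidden a b c ↔ basicForbidden a b c ∨ basicForbidden a.conv c b ∨
      basicForbidden c b.conv a ∨ basicForbidden b c.conv a.conv ∨
      basicForbidden c.conv a b.conv ∨ basicForbidden b.conv a.conv c.conv := by
  simp only [← basicForbidden_iff]
  constructor
  · rintro (h | h | h | h | h | h) <;> simp [h]
  · rintro (h | h | h | h | h | h)
    · exact .t₁ h
    · simpa using Forbidden.t₂ h
    · simpa using Forbidden.t₃ h
    · simpa using Forbidden.t₅ h
    · simpa using Forbidden.t₄ h
    · simpa using Forbidden.t₆ h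

theorem consistent_iff {a b c : RainbowAtom S T} :
    Consistent a b c ↔ ¬ basicForbidden a b c ∧ ¬ basicForbidden a.conv c b ∧
      ¬ basicForbidden c b.conv a ∧ ¬ basicForbidden b c.conv a.conv ∧
      ¬ basicForbidden c.conv a b.conv ∧ ¬ basicForbidden b.conv a.conv c.conv := by
  simp only [Consistent, forbidden_iff, not_or]

theorem Consistent.rotate_left {a b c : RainbowAtom S T} (h : Consistent a b c) :
    Consistent a.conv c b := by
  rw [consistent_iff] at h ⊢
  simp only [conv_conv]
  tauto

theorem Consistent.rotate_right {a b c : RainbowAtom S T} (h : Consistent a b c) :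
    Consistent c b.conv a := by
  rw [consistent_iff] at h ⊢
  simp only [conv_conv]
  tauto

theorem Consistent.conv {a b c : RainbowAtom S T} (h : Consistent a b c) :
    Consistent b.conv a.conv c.conv := by
  rw [consistent_iff] at h ⊢
  simp only [conv_conv]
  tauto

theorem consistent_ident_left {a b : RainbowAtom S T} : Consistent ident a b ↔ a = b := by
  rw [consistent_iff]
  cases a <;> cases b <;> simp [basicForbidden] <;> grind

theorem consistent_ident_right {a b : RainbowAtom S T} : Consistent a ident b ↔ a = b := by
  constructor
  · intro h
    have := consistent_ident_left.1 h.conv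
    rwa [conv_eq_iff, conv_conv] at this
  · rintro rfl
    simpa using (consistent_ident_left.2 (rfl : a.conv = a.conv)).conv

theorem consistent_ident {a b : RainbowAtom S T} : Consistent a b ident ↔ b = a.conv := by
  constructor
  · intro h
    exact (consistent_ident_right.1 h.rotate_left).symm
  · rintro rfl
    simpa using (consistent_ident_right.2 (rfl : a.conv = a.conv)).rotate_left

/-- Being a green atom. -/
def IsGreen (a : RainbowAtom S T) : Prop := ∃ i, a = green i

@[simp] theorem isGreen_green (i : S) : (green i : RainbowAtom S T).IsGreen := ⟨i, rfl⟩

@[simp] theorem isGreen_conv {a : RainbowAtom S T} : a.conv.IsGreen ↔ a.IsGreen := by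
  simp [IsGreen, conv_eq_iff]

/-- Away from the identity, white is forbidden only beside two greens and, in the next lemma, black
only beside two yellows. -/
theorem consistent_white {a b : RainbowAtom S T} (ha : a ≠ ident) (hb : b ≠ ident)
    (h : ¬ (a.IsGreen ∧ b.IsGreen)) : Consistent a white b := by
  rw [consistent_iff]
  cases a <;> cases b <;> simp_all [basicForbidden]

theorem consistent_black {a b : RainbowAtom S T} (ha : a ≠ ident) (hb : b ≠ ident)
    (h : ¬ (a = yellow ∧ b = yellow)) : Consistent a black b := by
  rw [consistent_iff]
  cases a <;> cases b <;> simp_all [basicForbidden]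

theorem consistent_green_red_green {i i' : S} {j j' : T} :
    Consistent (green i) (red j j') (green i') ↔ i ≠ i' ∧ j ≠ j' := by
  rw [consistent_iff]
  simp only [conv_green, conv_red, basicForbidden]
  grind

theorem consistent_yellow_red_yellow {j j' : T} :
    Consistent (S := S) yellow (red j j') yellow := by
  rw [consistent_iff]
  simp [basicForbidden]

theorem consistent_red {j₁ j₂ j₂' j₃ j₁' j₃' : T} :
    Consistent (S := S) (red j₁ j₂) (red j₂' j₃) (red j₁' j₃') ↔
      j₁ = j₁' ∧ j₂ = j₂' ∧ j₃ = j₃' := by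
  rw [consistent_iff]
  simp only [conv_red, basicForbidden]
  grind

/-- White, black and red are the labels given to the edges that are not prescribed. -/
def IsNeutral (a : RainbowAtom S T) : Prop := a = white ∨ a = black ∨ ∃ j j', a = red j j'

/-- A forbidden triple without the identity has two greens, two yellows or three reds, so two
neutral entries leave only the all-red case to check. -/
theorem consistent_neutral {a b c : RainbowAtom S T} (ha : a.IsNeutral) (hb : b.IsNeutral)
    (hc : c ≠ ident) (h : ∀ j₁ j₂ j₃ j₄, a = red j₁ j₂ → b = red j₃ j₄ → Consistent a b c) :
    Consistent a b c := by
  rcases ha with rfl | rfl | ⟨j₁, j₂, rfl⟩ <;> rcases hb with rfl | rfl | ⟨j₃, j₄, rfl⟩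
  case inr.inr.inr.inr => exact h _ _ _ _ rfl rfl
  all_goals
    rw [consistent_iff]
    cases c <;> simp_all [basicForbidden]

/-- Two points that see one point through green and another through yellow are equal or joined by
a red edge. -/
theorem eq_ident_or_red {i i' : S} {c : RainbowAtom S T} (hg : Consistent (green i) c (green i'))
    (hy : Consistent yellow c yellow) :
    (c = ident ∧ i = i') ∨ ∃ j j', c = red j j' ∧ i ≠ i' ∧ j ≠ j' := by
  cases c
  case ident => exact .inl ⟨rfl, by simpa using consistent_ident_right.1 hg⟩
  case red j j' => exact .inr ⟨j, j', rfl, consistent_green_red_green.1 hg⟩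
  all_goals
    rw [consistent_iff] at hg hy
    simp_all [basicForbidden]

/-- The labels of a red clique are given by an index of its points. -/
theorem exists_index {X : Type*} (C : Set X) (L : X → X → RainbowAtom S T) [Nonempty T]
    (hred : ∀ x ∈ C, ∀ y ∈ C, x ≠ y → ∃ j j', L x y = red j j')
    (hconv : ∀ x ∈ C, ∀ y ∈ C, L y x = (L x y).conv)
    (hcons : ∀ x ∈ C, ∀ y ∈ C, ∀ z ∈ C, Consistent (L x y) (L y z) (L x z)) :
    ∃ f : X → T, ∀ x ∈ C, ∀ y ∈ C, x ≠ y → L x y = red (f x) (f y) := by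
  have key : ∀ x, ∃ j : T, x ∈ C → ∀ y ∈ C, x ≠ y → ∃ j', L x y = red j j' := by
    intro x
    by_cases h : x ∈ C ∧ ∃ y ∈ C, x ≠ y
    · obtain ⟨hx, y, hy, hxy⟩ := h
      obtain ⟨j, j', hj⟩ := hred x hx y hy hxy
      refine ⟨j, fun _ z hz hxz => ?_⟩
      obtain ⟨k, k', hk⟩ := hred x hx z hz hxz
      by_cases hyz : y = z
      · exact ⟨j', hyz ▸ hj⟩
      · obtain ⟨l, l', hl⟩ := hred y hy z hz hyz
        -- In a red triangle the two edges leaving a point share their first index, so the index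
        -- does not depend on the edge chosen.
        have := hcons x hx y hy z hz
        rw [hj, hk, hl, consistent_red] at this
        exact ⟨k', by rw [hk, this.1]⟩
    -- With no other point in the clique, any index will do.
    · exact ⟨Classical.arbitrary T, fun hx y hy hxy => (h ⟨hx, y, hy, hxy⟩).elim⟩
  choose f hf using key
  refine ⟨f, fun x hx y hy hxy => ?_⟩
  obtain ⟨j', hj'⟩ := hf x hx y hy hxy
  obtain ⟨k', hk'⟩ := hf y hy x hx hxy.symm
  rw [hconv x hx y hy, hj', conv_red] at hk'
  rw [hj', (RainbowAtom.red.inj hk').1]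

/-- The amalgamation property that makes composition in the complex algebra associative. -/
theorem exists_consistent [Nontrivial T] {a b c d e : RainbowAtom S T} (h₁ : Consistent a b c)
    (h₂ : Consistent c d e) : ∃ f, Consistent b d f ∧ Consistent a f e := by
  by_cases ha : a = ident
  · subst ha
    obtain rfl := consistent_ident_left.1 h₁
    exact ⟨e, h₂, consistent_ident_left.2 rfl⟩
  by_cases hb : b = ident
  · subst hb
    obtain rfl := consistent_ident_right.1 h₁
    exact ⟨d, consistent_ident_left.2 rfl, h₂⟩
  by_cases hd : d = ident
  · subst hd
    obtain rfl := consistent_ident_right.1 h₂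
    exact ⟨b, consistent_ident_right.2 rfl, h₁⟩
  by_cases he : e = ident
  · subst he
    obtain rfl := consistent_ident.1 h₂
    exact ⟨a.conv, by simpa using h₁.rotate_right.conv, consistent_ident.2 rfl⟩
  have hb' : b.conv ≠ ident := by simpa
  by_cases hw : ¬ (b.IsGreen ∧ d.IsGreen) ∧ ¬ (a.IsGreen ∧ e.IsGreen)
  · exact ⟨white, by simpa using (consistent_white hb' hd (by simpa using hw.1)).rotate_left,
      consistent_white ha he hw.2⟩
  by_cases hk : ¬ (b = yellow ∧ d = yellow) ∧ ¬ (a = yellow ∧ e = yellow)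
  · exact ⟨black,
      by simpa using (consistent_black hb' hd (by simpa [conv_eq_iff] using hk.1)).rotate_left,
      consistent_black ha he hk.2⟩
  -- White and black both fail only if one pair is green and the other yellow. Equal greens allow
  -- the identity; different greens need a red with two distinct indices.
  obtain ⟨j, j', hj⟩ := exists_pair_ne T
  have : (∃ i i', b = green i ∧ d = green i' ∧ a = yellow ∧ e = yellow) ∨
      (∃ i i', a = green i ∧ e = green i' ∧ b = yellow ∧ d = yellow) := by
    unfold IsGreen at hw
    grind
  rcases this with ⟨i, i', rfl, rfl, rfl, rfl⟩ | ⟨i, i', rfl, rfl, rfl, rfl⟩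
  · by_cases hi : i = i'
    · subst hi
      exact ⟨ident, consistent_ident.2 rfl, consistent_ident_right.2 rfl⟩
    · exact ⟨red j j', (consistent_green_red_green.2 ⟨hi, hj⟩).rotate_left,
        consistent_yellow_red_yellow⟩
  · by_cases hi : i = i'
    · subst hi
      exact ⟨ident, consistent_ident.2 rfl, consistent_ident_right.2 rfl⟩
    · exact ⟨red j j', consistent_yellow_red_yellow.rotate_left,
        consistent_green_red_green.2 ⟨hi, hj⟩⟩

end RainbowAtom

/-! ### The complex algebra -/

namespace RainbowAtom

variable {S T : Type u}

/-- The complex algebra of a rainbow atom structure. -/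
@[reducible] def complexAlgebra (S T : Type u) [Nontrivial T] :
    RelationAlgebra (Set (RainbowAtom S T)) where
  __ := (inferInstance : BooleanAlgebra (Set (RainbowAtom S T)))
  ident := {ident}
  conv A := {a | a.conv ∈ A}
  comp A B := {c | ∃ a ∈ A, ∃ b ∈ B, Consistent a b c}
  comp_assoc A B C := by
    ext e
    constructor
    · rintro ⟨c, ⟨a, ha, b, hb, h₁⟩, d, hd, h₂⟩
      obtain ⟨f, hf₁, hf₂⟩ := exists_consistent h₁ h₂
      exact ⟨a, ha, f, ⟨b, hb, d, hd, hf₁⟩, hf₂⟩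
    · rintro ⟨a, ha, f, ⟨b, hb, d, hd, h₁⟩, h₂⟩
      -- The other inclusion is the same amalgamation, read through converse.
      obtain ⟨c, hc₁, hc₂⟩ := exists_consistent h₁.conv h₂.conv
      exact ⟨c.conv, ⟨a, ha, b, hb, by simpa using hc₁.conv⟩, d, hd, by simpa using hc₂.conv⟩
  ident_comp A := by
    ext a
    simp [consistent_ident_left]
  comp_ident A := by
    ext a
    simp [consistent_ident_right]
  conv_conv A := by simp
  conv_comp A B := by
    ext c
    constructor
    · rintro ⟨a, ha, b, hb, h⟩
      exact ⟨b.conv, by simpa using hb, a.conv, by simpa using ha, by simpa using h.conv⟩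
    · rintro ⟨b, hb, a, ha, h⟩
      exact ⟨a.conv, ha, b.conv, hb, h.conv⟩
  conv_bot := by simp
  conv_sup A B := by
    ext
    simp
  bot_comp A := by simp
  comp_bot A := by simp
  sup_comp A B C := by
    ext c
    simp [or_and_right, exists_or]
  comp_sup A B C := by
    ext c
    simp [or_and_right, exists_or, and_or_left]
  peircean A B := by
    rintro c ⟨p, hp, q, hq, h⟩ hc
    exact hq ⟨p.conv, hp, c, hc, h.rotate_left⟩

theorem nonempty_iso_complexAlgebra (S T : Type u) [Nontrivial T] :
    Nonempty ((rainbow S T).Iso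
      (@AtomStructure.ofRA (Set (RainbowAtom S T)) (complexAlgebra S T))) := by
  let _ := complexAlgebra S T
  refine ⟨{ toEquiv := Equiv.ofBijective (fun a => ⟨{a}, Set.isAtom_singleton a⟩) ⟨?_, ?_⟩,
            map_isId := ?_, map_conv := ?_, map_consistent := ?_ }⟩
  · intro a b h
    exact Set.singleton_injective (congrArg Subtype.val h)
  · rintro ⟨A, hA⟩
    obtain ⟨a, rfl⟩ := Set.isAtom_iff.1 hA
    exact ⟨a, rfl⟩
  · intro a
    exact Set.singleton_subset_iff
  · intro (a : RainbowAtom S T) (b : RainbowAtom S T)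
    change ({b} : Set (RainbowAtom S T)) = {c | c.conv ∈ ({a} : Set (RainbowAtom S T))} ↔ b = a.conv
    have : {c : RainbowAtom S T | c.conv ∈ ({a} : Set (RainbowAtom S T))} = {a.conv} := by
      ext c
      simp [conv_eq_iff]
    rw [this, Set.singleton_eq_singleton_iff]
  · intro (a : RainbowAtom S T) (b : RainbowAtom S T) (c : RainbowAtom S T)
    change ({c} : Set (RainbowAtom S T)) ⊆ {c | ∃ a' ∈ ({a} : Set (RainbowAtom S T)),
      ∃ b' ∈ ({b} : Set (RainbowAtom S T)), Consistent a' b' c} ↔ Consistent a b c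
    simp

theorem rainbow_mem_atRA (S T : Type u) [Nontrivial T] : rainbow S T ∈ AtomStructure.atRA.{u} :=
  ⟨Set (RainbowAtom S T), complexAlgebra S T, inferInstanceAs (IsAtomic (Set (RainbowAtom S T))),
    nonempty_iso_complexAlgebra S T⟩

/-! ### Consistent networks and one-point extensions -/

/-- The labelling `L` is a consistent network on the points of `D`. -/
structure IsNetwork {X : Type*} (D : Set X) (L : X → X → RainbowAtom S T) : Prop where
  label_self : ∀ x ∈ D, L x x = ident
  eq_of_label : ∀ x ∈ D, ∀ y ∈ D, L x y = ident → x = y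
  consistent : ∀ x ∈ D, ∀ y ∈ D, ∀ z ∈ D, Consistent (L x y) (L y z) (L x z)

namespace IsNetwork

variable {X : Type*} {D : Set X} {L : X → X → RainbowAtom S T}

theorem label_conv (h : IsNetwork D L) {x y : X} (hx : x ∈ D) (hy : y ∈ D) :
    L y x = (L x y).conv := by
  have := h.consistent x hx y hy x hx
  rwa [h.label_self x hx, consistent_ident] at this

open Classical in
/-- The labelling `L` with the new point `z`, to which `l` gives the labels. -/
noncomputable def extend (L : X → X → RainbowAtom S T) (z : X) (l : X → RainbowAtom S T) (x y : X) :
    RainbowAtom S T :=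
  if x = z then if y = z then ident else (l y).conv else if y = z then l x else L x y

theorem isNetwork_extend (h : IsNetwork D L) {z : X} (hz : z ∉ D) {l : X → RainbowAtom S T}
    (hl : ∀ x ∈ D, l x ≠ ident)
    (hc : ∀ x ∈ D, ∀ y ∈ D, Consistent (l x) (l y).conv (L x y)) :
    IsNetwork (insert z D) (extend L z l) := by
  have hne : ∀ x ∈ D, x ≠ z := fun x hx hxz => hz (hxz ▸ hx)
  have h₁ : extend L z l z z = ident := by simp [extend]
  have h₂ : ∀ x ∈ D, extend L z l x z = l x := fun x hx => by simp [extend, hne x hx]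
  have h₃ : ∀ x ∈ D, extend L z l z x = (l x).conv := fun x hx => by simp [extend, hne x hx]
  have h₄ : ∀ x ∈ D, ∀ y ∈ D, extend L z l x y = L x y := fun x hx y hy => by
    simp [extend, hne x hx, hne y hy]
  refine ⟨?_, ?_, ?_⟩
  · rintro x (rfl | hx)
    · exact h₁
    · rw [h₄ x hx x hx, h.label_self x hx]
  · rintro x (rfl | hx) y (rfl | hy) hxy
    · rfl
    · rw [h₃ y hy, conv_eq_ident] at hxy
      exact (hl y hy hxy).elim
    · rw [h₂ x hx] at hxy
      exact (hl x hx hxy).elim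
    · rw [h₄ x hx y hy] at hxy
      exact h.eq_of_label x hx y hy hxy
  · rintro x (rfl | hx) y (rfl | hy) w (rfl | hw)
    · rw [h₁, consistent_ident_left]
    · rw [h₁, consistent_ident_left]
    · rw [h₁, h₂ y hy, h₃ y hy, consistent_ident]
      simp
    · rw [h₃ y hy, h₃ w hw, h₄ y hy w hw]
      exact (hc y hy w hw).rotate_left
    · rw [h₁, consistent_ident_right]
    · rw [h₂ x hx, h₃ w hw, h₄ x hx w hw]
      exact hc x hx w hw
    · rw [h₂ x hx, h₂ y hy, h₄ x hx y hy]
      simpa using (hc x hx y hy).rotate_right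
    · rw [h₄ x hx y hy, h₄ x hx w hw, h₄ y hy w hw]
      exact h.consistent x hx y hy w hw

/-- The labels of the edges that lead from the points of a cone with green and yellow sides to the
apex that is added to it. -/
theorem exists_reds [Finite S] {L : X → X → RainbowAtom S S} (h : IsNetwork D L) {x y : X}
    (hx : x ∈ D) (hy : y ∈ D) {i : S} (hi : ∀ u ∈ D, ¬ (L x u = green i ∧ L y u = yellow)) :
    ∃ (f : X → S) (j : S), ∀ u ∈ D, (L x u).IsGreen → L y u = yellow → f u ≠ j ∧
      ∀ v ∈ D, (L x v).IsGreen → L y v = yellow → u ≠ v → L u v = red (f u) (f v) := by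
  let C : Set X := {u | u ∈ D ∧ (L x u).IsGreen ∧ L y u = yellow}
  have : Nonempty S := ⟨i⟩
  have hC : ∀ u ∈ C, ∀ v ∈ C, u ≠ v → ∃ i₁ i₂ j j', L x u = green i₁ ∧ L x v = green i₂ ∧
      L u v = red j j' ∧ i₁ ≠ i₂ ∧ j ≠ j' := by
    rintro u ⟨hu, ⟨i₁, h₁⟩, hu'⟩ v ⟨hv, ⟨i₂, h₂⟩, hv'⟩ huv
    have h₃ := h.consistent x hx u hu v hv
    have h₄ := h.consistent y hy u hu v hv
    rw [h₁, h₂] at h₃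
    rw [hu', hv'] at h₄
    obtain ⟨h₅, -⟩ | ⟨j, j', h₅, h₆, h₇⟩ := eq_ident_or_red h₃ h₄
    · exact (huv (h.eq_of_label u hu v hv h₅)).elim
    · exact ⟨i₁, i₂, j, j', h₁, h₂, h₅, h₆, h₇⟩
  obtain ⟨f, hf⟩ := exists_index C L
    (fun u hu v hv huv => by
      obtain ⟨_, _, j, j', _, _, h₁, _⟩ := hC u hu v hv huv
      exact ⟨j, j', h₁⟩)
    (fun u hu v hv => h.label_conv hu.1 hv.1)
    (fun u hu v hv w hw => h.consistent u hu.1 v hv.1 w hw.1)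
  have hfinj : Function.Injective fun u : C => f u := by
    intro u v huv
    by_contra hne
    have hne' : (u : X) ≠ v := fun h => hne (Subtype.ext h)
    obtain ⟨_, _, j, j', _, _, h₁, _, h₂⟩ := hC u u.2 v v.2 hne'
    rw [hf u u.2 v v.2 hne', RainbowAtom.red.injEq] at h₁
    exact h₂ (h₁.1 ▸ h₁.2 ▸ huv)
  -- Pigeonhole: if all red indices were used, a section `e` of `f`, followed by the injective green
  -- index `g`, would be an injection of the finite set `S` into itself. It would be onto and reach
  -- the missing green `i`.
  have hj : ∃ j, ∀ u : C, f u ≠ j := by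
    by_contra! hsurj
    choose g hg using fun u : C => u.2.2.1
    have hginj : Function.Injective g := by
      intro u v huv
      by_contra hne
      obtain ⟨i₁, i₂, _, _, h₁, h₂, _, h₃, _⟩ := hC u u.2 v v.2 fun h => hne (Subtype.ext h)
      rw [hg u, RainbowAtom.green.injEq] at h₁
      rw [hg v, RainbowAtom.green.injEq] at h₂
      exact h₃ (h₁ ▸ h₂ ▸ huv)
    choose e he using hsurj
    have heinj : Function.Injective e := fun a b hab => by rw [← he a, ← he b, hab]
    obtain ⟨s, hs⟩ := (Finite.injective_iff_surjective.1 (hginj.comp heinj)) i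
    exact hi (e s) (e s).2.1 ⟨by rw [hg (e s)]; exact congrArg _ hs, (e s).2.2.2⟩
  obtain ⟨j, hj⟩ := hj
  exact ⟨f, j, fun u hu h₁ h₂ => ⟨hj ⟨u, hu, h₁, h₂⟩, fun v hv h₃ h₄ huv =>
    hf u ⟨hu, h₁, h₂⟩ v ⟨hv, h₃, h₄⟩ huv⟩⟩

/-- The remaining edges to the new point are white if possible, else black, else red. Red is needed
only at points of the green-yellow cone over `x` and `y`, and there `exists_reds` supplies a fresh
index for the new point. -/
theorem exists_labels_aux [Finite S] [Nonempty S] {L : X → X → RainbowAtom S S}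
    (h : IsNetwork D L) {x y : X}
    (hx : x ∈ D) (hy : y ∈ D) {p q : RainbowAtom S S} (hp : p ≠ ident) (hq : q ≠ ident)
    (hpq : Consistent p q.conv (L x y)) (hno : ∀ u ∈ D, ¬ (L x u = p ∧ L y u = q))
    (hyg : ¬ (p = yellow ∧ q.IsGreen)) :
    ∃ l : X → RainbowAtom S S, l x = p ∧ l y = q ∧ (∀ u ∈ D, l u ≠ ident) ∧
      ∀ u ∈ D, ∀ v ∈ D, Consistent (l u) (l v).conv (L u v) := by
  classical
  obtain ⟨f, j, hf⟩ : ∃ (f : X → S) (j : S), p.IsGreen → q = yellow →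
      ∀ u ∈ D, (L x u).IsGreen → L y u = yellow → f u ≠ j ∧
      ∀ v ∈ D, (L x v).IsGreen → L y v = yellow → u ≠ v → L u v = red (f u) (f v) := by
    by_cases hgy : p.IsGreen ∧ q = yellow
    · obtain ⟨⟨i, rfl⟩, rfl⟩ := hgy
      obtain ⟨f, j, hf⟩ := h.exists_reds hx hy hno
      exact ⟨f, j, fun _ _ => hf⟩
    -- No red edge is used in this case, so the values are irrelevant.
    · exact ⟨fun _ => Classical.arbitrary S, Classical.arbitrary S, fun h₁ h₂ => (hgy ⟨h₁, h₂⟩).elim⟩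
  -- `G` records that green rules out white at `u`, and `Y` that yellow rules out black.
  let G (u : X) : Prop := (p.IsGreen ∧ (L x u).IsGreen) ∨ (q.IsGreen ∧ (L y u).IsGreen)
  let Y (u : X) : Prop := (p = yellow ∧ L x u = yellow) ∨ (q = yellow ∧ L y u = yellow)
  have hGY : ∀ u, G u → Y u → p.IsGreen ∧ q = yellow ∧ (L x u).IsGreen ∧ L y u = yellow := by
    rintro u (⟨⟨i, rfl⟩, h₂⟩ | ⟨⟨i, rfl⟩, h₂⟩) (⟨h₃, h₄⟩ | ⟨h₃, h₄⟩)
    · cases h₃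
    · exact ⟨⟨i, rfl⟩, h₃, h₂, h₄⟩
    · exact (hyg ⟨h₃, i, rfl⟩).elim
    · cases h₃
  let n (u : X) : RainbowAtom S S :=
    if G u then if Y u then red (f u) j else black else white
  have hn : ∀ u, (n u = white ∧ ¬ G u) ∨ (n u = black ∧ ¬ Y u) ∨
      (n u = red (f u) j ∧ G u ∧ Y u) := by
    intro u
    by_cases h₁ : G u <;> by_cases h₂ : Y u <;> simp [n, h₁, h₂]
  have hnn : ∀ u, (n u).IsNeutral ∧ (n u).conv.IsNeutral := by
    intro u
    rcases hn u with h₁ | h₁ | h₁ <;> rw [h₁.1] <;> simp [IsNeutral]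
  have hni : ∀ u, n u ≠ ident := by
    intro u
    rcases hn u with h₁ | h₁ | h₁ <;> rw [h₁.1] <;> simp
  let l (u : X) : RainbowAtom S S := if u = x then p else if u = y then q else n u
  have hlx : l x = p := by simp [l]
  have hly : l y = q := by
    -- The two base points may coincide; consistency over the identity then forces `p = q`.
    by_cases hyx : y = x
    · subst hyx
      rw [h.label_self y hy, consistent_ident, conv_eq_iff, conv_conv] at hpq
      rw [hlx, hpq]
    · simp [l, hyx]
  have hln : ∀ u, u ≠ x → u ≠ y → l u = n u := fun u h₁ h₂ => by simp [l, h₁, h₂]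
  have hsymm : ∀ u ∈ D, ∀ v ∈ D, Consistent (l u) (l v).conv (L u v) →
      Consistent (l v) (l u).conv (L v u) := by
    intro u hu v hv huv
    rw [h.label_conv hu hv]
    simpa using huv.conv
  have hself : ∀ u ∈ D, Consistent (l u) (l u).conv (L u u) := fun u hu => by
    rw [h.label_self u hu, consistent_ident]
  have hxn : ∀ v ∈ D, v ≠ x → v ≠ y → Consistent (l x) (l v).conv (L x v) := by
    intro v hv h₁ h₂
    have h₃ : L x v ≠ ident := fun h₃ => h₁ (h.eq_of_label x hx v hv h₃).symm
    rw [hlx, hln v h₁ h₂]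
    rcases hn v with ⟨h₄, h₅⟩ | ⟨h₄, h₅⟩ | ⟨h₄, h₅, h₆⟩ <;> rw [h₄]
    · exact consistent_white hp h₃ fun h₆ => h₅ (.inl h₆)
    · exact consistent_black hp h₃ fun h₆ => h₅ (.inl h₆)
    · obtain ⟨⟨i, rfl⟩, rfl, ⟨i', hi'⟩, h₇⟩ := hGY v h₅ h₆
      rw [hi', conv_red, consistent_green_red_green]
      refine ⟨?_, ((hf ⟨i, rfl⟩ rfl v hv ⟨i', hi'⟩ h₇).1).symm⟩
      rintro rfl
      exact hno v hv ⟨hi', h₇⟩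
  have hyn : ∀ v ∈ D, v ≠ x → v ≠ y → Consistent (l y) (l v).conv (L y v) := by
    intro v hv h₁ h₂
    have h₃ : L y v ≠ ident := fun h₃ => h₂ (h.eq_of_label y hy v hv h₃).symm
    rw [hly, hln v h₁ h₂]
    rcases hn v with ⟨h₄, h₅⟩ | ⟨h₄, h₅⟩ | ⟨h₄, h₅, h₆⟩ <;> rw [h₄]
    · exact consistent_white hq h₃ fun h₆ => h₅ (.inr h₆)
    · exact consistent_black hq h₃ fun h₆ => h₅ (.inr h₆)
    · obtain ⟨_, rfl, _, h₇⟩ := hGY v h₅ h₆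
      rw [h₇, conv_red]
      exact consistent_yellow_red_yellow
  refine ⟨l, hlx, hly, fun u _ => ?_, fun u hu v hv => ?_⟩
  · by_cases h₁ : u = x
    · rwa [h₁, hlx]
    · by_cases h₂ : u = y
      · rwa [h₂, hly]
      · rw [hln u h₁ h₂]
        exact hni u
  · by_cases huv : u = v
    · exact huv ▸ hself u hu
    by_cases h₁ : u = x
    · subst h₁
      by_cases h₂ : v = y
      · subst h₂
        rwa [hlx, hly]
      · exact hxn v hv (Ne.symm huv) h₂
    by_cases h₂ : u = y
    · subst h₂
      by_cases h₃ : v = x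
      · subst h₃
        exact hsymm _ hx _ hy (by rwa [hlx, hly])
      · exact hyn v hv h₃ (Ne.symm huv)
    by_cases h₃ : v = x
    · subst h₃
      exact hsymm _ hx _ hu (hxn u hu h₁ h₂)
    by_cases h₄ : v = y
    · subst h₄
      exact hsymm _ hy _ hu (hyn u hu h₁ h₂)
    rw [hln u h₁ h₂, hln v h₃ h₄]
    refine consistent_neutral (hnn u).1 (hnn v).2
      (fun h₅ => huv (h.eq_of_label u hu v hv h₅)) fun j₁ j₂ j₃ j₄ h₅ h₆ => ?_
    rcases hn u with ⟨h₇, h₈⟩ | ⟨h₇, h₈⟩ | ⟨h₇, h₈, h₉⟩ <;> rw [h₇] at h₅ ⊢ <;> try cases h₅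
    rcases hn v with ⟨h₁₀, h₁₁⟩ | ⟨h₁₀, h₁₁⟩ | ⟨h₁₀, h₁₁, h₁₂⟩ <;> rw [h₁₀] at h₆ ⊢ <;> try cases h₆
    obtain ⟨h₁₃, h₁₄, h₁₅, h₁₆⟩ := hGY u h₈ h₉
    obtain ⟨-, -, h₁₇, h₁₈⟩ := hGY v h₁₁ h₁₂
    -- The triangle of `red (f u) j`, `red j (f v)` and `red (f u) (f v)` has matching indices at
    -- all three corners.
    rw [(hf h₁₃ h₁₄ u hu h₁₅ h₁₆).2 v hv h₁₇ h₁₈ huv, conv_red, consistent_red]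
    exact ⟨rfl, rfl, rfl⟩

/-- The yellow-green case becomes the green-yellow one on exchanging `x` and `y`. -/
theorem exists_labels [Finite S] [Nonempty S] {L : X → X → RainbowAtom S S}
    (h : IsNetwork D L) {x y : X}
    (hx : x ∈ D) (hy : y ∈ D) {p q : RainbowAtom S S} (hp : p ≠ ident) (hq : q ≠ ident)
    (hpq : Consistent p q.conv (L x y)) (hno : ∀ u ∈ D, ¬ (L x u = p ∧ L y u = q)) :
    ∃ l : X → RainbowAtom S S, l x = p ∧ l y = q ∧ (∀ u ∈ D, l u ≠ ident) ∧
      ∀ u ∈ D, ∀ v ∈ D, Consistent (l u) (l v).conv (L u v) := by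
  by_cases hyg : p = yellow ∧ q.IsGreen
  · obtain ⟨l, h₁, h₂, h₃, h₄⟩ := h.exists_labels_aux hy hx hq hp
      (by rw [h.label_conv hx hy]; simpa using hpq.conv) (fun u hu h₁ => hno u hu h₁.symm)
      (by
        rintro ⟨rfl, -⟩
        obtain ⟨i, hi⟩ := hyg.2
        cases hi)
    exact ⟨l, h₂, h₁, h₃, h₄⟩
  · exact h.exists_labels_aux hx hy hp hq hpq hno hyg

/-- A consistent network extends, by at most the given new point, to one that has a witness for
the given consistent triple. -/
theorem exists_extension [Finite S] [Nonempty S] {L : X → X → RainbowAtom S S}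
    (h : IsNetwork D L) {x y : X} (hx : x ∈ D) (hy : y ∈ D) {a b : RainbowAtom S S}
    (hab : Consistent a b (L x y)) {z : X} (hz : z ∉ D) :
    ∃ D' L', D ⊆ D' ∧ D' ⊆ insert z D ∧ IsNetwork D' L' ∧ (∀ u ∈ D, ∀ v ∈ D, L' u v = L u v) ∧
      ∃ w ∈ D', L' x w = a ∧ L' w y = b := by
  by_cases hw : ∃ w ∈ D, L x w = a ∧ L w y = b
  · exact ⟨D, L, subset_rfl, Set.subset_insert z D, h, fun _ _ _ _ => rfl, hw⟩
  have ha : a ≠ ident := by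
    rintro rfl
    exact hw ⟨x, hx, h.label_self x hx, (consistent_ident_left.1 hab).symm⟩
  have hb : b.conv ≠ ident := by
    rw [Ne, conv_eq_ident]
    rintro rfl
    exact hw ⟨y, hy, (consistent_ident_right.1 hab).symm, h.label_self y hy⟩
  obtain ⟨l, hlx, hly, hl, hc⟩ := h.exists_labels hx hy ha hb (by simpa) (fun u hu h₁ =>
    hw ⟨u, hu, h₁.1, by rw [h.label_conv hy hu, h₁.2, conv_conv]⟩)
  have hne : ∀ x ∈ D, x ≠ z := fun x hx hxz => hz (hxz ▸ hx)
  refine ⟨insert z D, extend L z l, Set.subset_insert z D, subset_rfl, h.isNetwork_extend hz hl hc,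
    fun u hu v hv => by simp [extend, hne u hu, hne v hv], z, Set.mem_insert z D, ?_, ?_⟩
  · simp [extend, hne x hx, hlx]
  · simp [extend, hne y hy, hly]

end IsNetwork

/-! ### Limits of finite networks and complete representations -/

/-- Finite networks with points in `ℕ`, ordered by extension. -/
structure FiniteNetwork (S : Type u) where
  points : Finset ℕ
  label : ℕ → ℕ → RainbowAtom S S
  isNetwork : IsNetwork (points : Set ℕ) label

namespace FiniteNetwork

instance : Preorder (FiniteNetwork S) where
  le N N' := N.points ⊆ N'.points ∧ ∀ x ∈ N.points, ∀ y ∈ N.points, N'.label x y = N.label x y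
  le_refl N := ⟨subset_rfl, fun _ _ _ _ => rfl⟩
  le_trans N N' N'' h h' := ⟨h.1.trans h'.1, fun x hx y hy => by
    rw [h'.2 x (h.1 hx) y (h.1 hy), h.2 x hx y hy]⟩

/-- White is safe on every edge to the new point, since two white sides are consistent with any
label but the identity. -/
theorem exists_mem_points (N : FiniteNetwork S) (z : ℕ) : ∃ N', N ≤ N' ∧ z ∈ N'.points := by
  by_cases hz : z ∈ N.points
  · exact ⟨N, le_rfl, hz⟩
  have hz' : z ∉ (N.points : Set ℕ) := hz
  have hne : ∀ x ∈ N.points, x ≠ z := fun x hx hxz => hz (hxz ▸ hx)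
  refine ⟨⟨insert z N.points, IsNetwork.extend N.label z fun _ => white, ?_⟩,
    ⟨Finset.subset_insert z N.points, fun u hu v hv => ?_⟩, Finset.mem_insert_self z N.points⟩
  · rw [Finset.coe_insert]
    refine N.isNetwork.isNetwork_extend hz' (fun _ _ => by simp) fun x hx y hy => ?_
    by_cases hxy : x = y
    · rw [hxy, N.isNetwork.label_self y hy, consistent_ident]
    · exact consistent_neutral (.inl rfl) (.inl rfl)
        (fun h => hxy (N.isNetwork.eq_of_label x hx y hy h)) (by simp)
  · simp [IsNetwork.extend, hne u hu, hne v hv]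

theorem exists_witness [Finite S] [Nonempty S] (N : FiniteNetwork S) {x y : ℕ} (hx : x ∈ N.points) (hy : y ∈ N.points)
    {a b : RainbowAtom S S} (hab : Consistent a b (N.label x y)) :
    ∃ N', N ≤ N' ∧ ∃ w ∈ N'.points, N'.label x w = a ∧ N'.label w y = b := by
  obtain ⟨z, hz⟩ := Infinite.exists_notMem_finset N.points
  obtain ⟨D, L, h₁, h₂, h₃, h₄, w, hw, h₅⟩ := N.isNetwork.exists_extension hx hy hab hz
  have hfin : D.Finite := (N.points.finite_toSet.insert z).subset h₂
  refine ⟨⟨hfin.toFinset, L, by simpa using h₃⟩, ⟨?_, h₄⟩, w, by simpa using hw, h₅⟩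
  intro u hu
  simpa using h₁ hu

/-- A Rasiowa–Sikorski argument: there are countably many requirements, each cofinal among finite
networks, so some ideal meets them all and its members glue together. -/
theorem exists_saturated (S : Type u) [Finite S] [Nonempty S] :
    ∃ L : ℕ → ℕ → RainbowAtom S S, IsNetwork Set.univ L ∧
      ∀ x y a b, Consistent a b (L x y) → ∃ z, L x z = a ∧ L z y = b := by
  have := Fintype.ofFinite (RainbowAtom S S)
  have : Encodable (RainbowAtom S S) := Fintype.toEncodable _
  let 𝒟 : ℕ × ℕ × RainbowAtom S S × RainbowAtom S S → Order.Cofinal (FiniteNetwork S) :=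
    fun t =>
    { carrier := {N | t.1 ∈ N.points ∧ t.2.1 ∈ N.points ∧
        (Consistent t.2.2.1 t.2.2.2 (N.label t.1 t.2.1) →
          ∃ z ∈ N.points, N.label t.1 z = t.2.2.1 ∧ N.label z t.2.1 = t.2.2.2)}
      isCofinal := by
        intro N
        obtain ⟨N₁, h₁, hx⟩ := N.exists_mem_points t.1
        obtain ⟨N₂, h₂, hy⟩ := N₁.exists_mem_points t.2.1
        by_cases hc : Consistent t.2.2.1 t.2.2.2 (N₂.label t.1 t.2.1)
        · obtain ⟨N₃, h₃, hw⟩ := N₂.exists_witness (h₂.1 hx) hy hc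
          exact ⟨N₃, ⟨h₃.1 (h₂.1 hx), h₃.1 hy, fun _ => hw⟩, h₁.trans (h₂.trans h₃)⟩
        · exact ⟨N₂, ⟨h₂.1 hx, hy, fun h => (hc h).elim⟩, h₁.trans h₂⟩ }
  let N₀ : FiniteNetwork S := ⟨∅, fun _ _ => ident, by constructor <;> simp⟩
  let I := Order.idealOfCofinals N₀ 𝒟
  have hmeet : ∀ t, ∃ N, N ∈ 𝒟 t ∧ N ∈ I := Order.cofinal_meets_idealOfCofinals N₀ 𝒟
  have hcover : ∀ x y, ∃ N ∈ I, x ∈ N.points ∧ y ∈ N.points := fun x y => by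
    -- The atoms are placeholders; only membership of `x` and `y` is needed.
    obtain ⟨N, h, hN⟩ := hmeet (x, y, ident, ident)
    exact ⟨N, hN, h.1, h.2.1⟩
  choose F hFI hFx hFy using hcover
  let L (x y : ℕ) := (F x y).label x y
  have hL : ∀ N ∈ I, ∀ x ∈ N.points, ∀ y ∈ N.points, L x y = N.label x y := by
    intro N hN x hx y hy
    obtain ⟨N', hN', h₁, h₂⟩ := I.directed N hN (F x y) (hFI x y)
    rw [← h₁.2 x hx y hy, h₂.2 x (hFx x y) y (hFy x y)]
  refine ⟨L, ⟨fun x _ => ?_, fun x _ y _ h => ?_, fun x _ y _ z _ => ?_⟩, fun x y a b h => ?_⟩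
  · exact (F x x).isNetwork.label_self x (hFx x x)
  · exact (F x y).isNetwork.eq_of_label x (hFx x y) y (hFy x y) h
  · obtain ⟨N, hN, h₁, h₂⟩ := I.directed (F x y) (hFI x y) (F z z) (hFI z z)
    have hx := h₁.1 (hFx x y)
    have hy := h₁.1 (hFy x y)
    have hz := h₂.1 (hFx z z)
    rw [hL N hN x hx y hy, hL N hN y hy z hz, hL N hN x hx z hz]
    exact N.isNetwork.consistent x hx y hy z hz
  · obtain ⟨N, ⟨hx, hy, hw⟩, hN⟩ := hmeet (x, y, a, b)
    rw [hL N hN x hx y hy] at h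
    obtain ⟨z, hz, h₁, h₂⟩ := hw h
    exact ⟨z, by rw [hL N hN x hx z hz]; exact h₁, by rw [hL N hN z hz y hy]; exact h₂⟩

end FiniteNetwork

/-- A saturated network is a representation: a set of atoms goes to its preimage under the
labelling, and preimages preserve all unions. -/
theorem completelyRepresentable_complexAlgebra (S : Type u) [Finite S] [Nontrivial S] :
    @RelationAlgebra.CompletelyRepresentable (Set (RainbowAtom S S)) (complexAlgebra S S) := by
  let _ := complexAlgebra S S
  obtain ⟨L, hL, hw⟩ := FiniteNetwork.exists_saturated S
  have hconv : ∀ x y, L y x = (L x y).conv := fun x y =>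
    hL.label_conv (Set.mem_univ x) (Set.mem_univ y)
  let r : RelationAlgebra.Representation (Set (RainbowAtom S S)) (ULift.{u} ℕ) :=
    { unit := ⊤
      θ := fun A => {p | L p.1.down p.2.down ∈ A}
      injective := by
        intro A B hAB
        ext a
        -- Every atom labels an edge leaving `0`, because `a` followed by its converse is consistent
        -- over the loop there.
        obtain ⟨z, hz, -⟩ := hw 0 0 a a.conv (by
          rw [hL.label_self 0 (Set.mem_univ 0), consistent_ident])
        have := Set.ext_iff.1 hAB (ULift.up 0, ULift.up z)
        simpa [hz] using this
      map_bot := rfl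
      map_top := rfl
      map_sup := fun A B => rfl
      map_compl := fun A => by
        ext p
        exact ⟨fun h => ⟨trivial, h⟩, fun h => h.2⟩
      map_ident := by
        ext ⟨⟨x⟩, ⟨y⟩⟩
        constructor
        · intro h
          exact congrArg ULift.up (hL.eq_of_label x (Set.mem_univ x) y (Set.mem_univ y) h)
        · intro h
          cases (h : ULift.up x = ULift.up y)
          exact hL.label_self x (Set.mem_univ x)
      map_conv := fun A => by
        ext ⟨⟨x⟩, ⟨y⟩⟩
        change (L x y).conv ∈ A ↔ L y x ∈ A
        rw [hconv x y]
      map_comp := fun A B => by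
        ext ⟨⟨x⟩, ⟨y⟩⟩
        constructor
        · rintro ⟨a, ha, b, hb, h⟩
          obtain ⟨z, rfl, rfl⟩ := hw x y a b h
          exact ⟨⟨z⟩, ha, hb⟩
        · rintro ⟨⟨z⟩, ha, hb⟩
          exact ⟨_, ha, _, hb,
            hL.consistent x (Set.mem_univ x) z (Set.mem_univ z) y (Set.mem_univ y)⟩ }
  refine ⟨ULift.{u} ℕ, r, fun s A hA => ?_⟩
  have hA' : IsLUB (α := Set (RainbowAtom S S)) s A := hA
  obtain rfl : A = ⋃₀ s := hA'.unique (isLUB_sSup s)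
  ext p
  change L p.1.down p.2.down ∈ ⋃₀ s ↔ _
  simp only [Set.mem_sUnion, Set.mem_iUnion, exists_prop]
  rfl

theorem rainbow_mem_atCRA (S : Type u) [Finite S] [Nontrivial S] :
    rainbow S S ∈ AtomStructure.atCRA.{u} :=
  ⟨Set (RainbowAtom S S), complexAlgebra S S, inferInstanceAs (IsAtomic (Set (RainbowAtom S S))),
    completelyRepresentable_complexAlgebra S, nonempty_iso_complexAlgebra S S⟩

end RainbowAtom

/-! ### Atoms in a representation -/

namespace RelationAlgebra.Representation

variable {A : Type u} [RelationAlgebra A] {X : Type u} (r : Representation A X)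

theorem mono {a b : A} (h : a ≤ b) : r.θ a ⊆ r.θ b := by
  rw [← sup_eq_right.2 h, r.map_sup]
  exact Set.subset_union_left

theorem le_of_mem {a b : A} (ha : IsAtom a) {p : X × X} (hpa : p ∈ r.θ a) (hpb : p ∈ r.θ b) :
    a ≤ b := by
  by_contra h
  have := r.mono (le_compl_iff_disjoint_right.2 (ha.not_le_iff_disjoint.1 h)) hpa
  rw [r.map_compl] at this
  exact this.2 hpb

theorem unit_of_mem {a : A} {p : X × X} (h : p ∈ r.θ a) : r.unit p.1 p.2 := by
  have := r.mono le_top h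
  rwa [r.map_top] at this

theorem nonempty_of_isAtom {a : A} (ha : IsAtom a) : (r.θ a).Nonempty := by
  rw [Set.nonempty_iff_ne_empty, ← r.map_bot]
  exact fun h => ha.1 (r.injective h)

/-- With finitely many atoms, `⊤` is a finite join of atoms, which every representation preserves;
completeness is not needed. -/
theorem exists_mem_atom [IsAtomic A] [Finite {a : A // IsAtom a}] {x y : X} (h : r.unit x y) :
    ∃ a, IsAtom a ∧ (x, y) ∈ r.θ a := by
  have hsup : ∀ s : Finset {a : A // IsAtom a}, (x, y) ∈ r.θ (s.sup Subtype.val) →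
      ∃ a, IsAtom a ∧ (x, y) ∈ r.θ a := by
    classical
    intro s
    induction s using Finset.induction_on with
    | empty =>
      rw [Finset.sup_empty, r.map_bot]
      exact fun h => h.elim
    | insert a s _ ih =>
      rw [Finset.sup_insert, r.map_sup]
      rintro (h | h)
      · exact ⟨a, a.2, h⟩
      · exact ih h
  have := Fintype.ofFinite {a : A // IsAtom a}
  refine hsup Finset.univ ?_
  have htop : Finset.univ.sup (Subtype.val : {a : A // IsAtom a} → A) = ⊤ := by
    rw [← compl_eq_bot]
    refine (eq_bot_or_exists_atom_le _).resolve_right ?_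
    rintro ⟨a, ha, h⟩
    exact ha.1 (le_bot_iff.1 ((le_inf (Finset.le_sup (f := Subtype.val)
      (Finset.mem_univ (⟨a, ha⟩ : {a : A // IsAtom a}))) h).trans_eq (inf_compl_self _)))
  rw [htop, r.map_top]
  exact h

end RelationAlgebra.Representation

/-! ### More greens than reds: no representation -/

namespace RainbowAtom

open RelationAlgebra in
/-- In a representation, the green-yellow cones over a black edge have their apexes in a red clique,
which gives different indices to the apexes of different green atoms. -/
theorem card_le_of_mem_atRRA {T S : Type u} [Finite T] [Finite S] [Nonempty S]
    (h : rainbow T S ∈ AtomStructure.atRRA.{u}) : Nat.card T ≤ Nat.card S := by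
  obtain ⟨A, _, _, ⟨X, ⟨r⟩⟩, ⟨e⟩⟩ := h
  let m (a : RainbowAtom T S) : A := (e.toEquiv a).1
  have hm : ∀ a, IsAtom (m a) := fun a => (e.toEquiv a).2
  have hminj : ∀ a b, m a = m b → a = b := fun a b hab => e.toEquiv.injective (Subtype.ext hab)
  have hcons : ∀ a b c, m c ≤ comp (m a) (m b) ↔ Consistent a b c := e.map_consistent
  have hconv : ∀ a, m a.conv = RelationAlgebra.conv (m a) := fun a => (e.map_conv a a.conv).2 rfl
  have hfin : Finite {a : A // IsAtom a} :=
    Finite.of_equiv (RainbowAtom T S) e.toEquiv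
  have hcover : ∀ x y, r.unit x y → ∃ a, (x, y) ∈ r.θ (m a) := by
    intro x y hxy
    obtain ⟨a, ha, h⟩ := r.exists_mem_atom hxy
    obtain ⟨b, hb⟩ := e.toEquiv.surjective ⟨a, ha⟩
    have hb' : m b = a := congrArg Subtype.val hb
    exact ⟨b, hb' ▸ h⟩
  have htri : ∀ x y z a b c, (x, y) ∈ r.θ (m a) → (y, z) ∈ r.θ (m b) → (x, z) ∈ r.θ (m c) →
      Consistent a b c := by
    intro x y z a b c h₁ h₂ h₃
    rw [← hcons]
    refine r.le_of_mem (hm c) h₃ ?_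
    rw [r.map_comp]
    exact ⟨y, h₁, h₂⟩
  have hflip : ∀ x y a, (x, y) ∈ r.θ (m a) → (y, x) ∈ r.θ (m a.conv) := by
    intro x y a h
    rw [hconv, r.map_conv]
    exact h
  have huniq : ∀ x y a b, (x, y) ∈ r.θ (m a) → (x, y) ∈ r.θ (m b) → a = b := fun x y a b h₁ h₂ =>
    hminj a b (((hm b).le_iff.1 (r.le_of_mem (hm a) h₁ h₂)).resolve_left (hm a).1)
  have hid : ∀ x y, (x, y) ∈ r.θ (m ident) → x = y := by
    intro x y h
    have := r.mono ((e.map_isId ident).2 rfl) h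
    rwa [r.map_ident] at this
  obtain ⟨⟨x, y⟩, hxy⟩ := r.nonempty_of_isAtom (hm black)
  have hz : ∀ i : T, ∃ z, (x, z) ∈ r.θ (m (green i)) ∧ (z, y) ∈ r.θ (m yellow) := by
    intro i
    have hc : Consistent (green i) (yellow : RainbowAtom T S) black := by
      rw [consistent_iff]
      simp [basicForbidden]
    have := r.mono ((hcons _ _ _).2 hc) hxy
    rwa [r.map_comp] at this
  choose z hxz hzy using hz
  have hunit : ∀ i i', r.unit (z i) (z i') := fun i i' =>
    r.unit.trans (r.unit.symm (r.unit_of_mem (hxz i))) (r.unit_of_mem (hxz i'))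
  choose L hL using fun i i' => hcover (z i) (z i') (hunit i i')
  have hred : ∀ i i', i ≠ i' → ∃ j j', L i i' = red j j' ∧ j ≠ j' := by
    intro i i' hi
    have h₁ := htri _ _ _ _ _ _ (hxz i) (hL i i') (hxz i')
    have h₂ := htri _ _ _ _ _ _ (hflip _ _ _ (hzy i)) (hL i i') (hflip _ _ _ (hzy i'))
    obtain ⟨-, h₃⟩ | ⟨j, j', h₃, -, h₄⟩ := eq_ident_or_red h₁ h₂
    · exact (hi h₃).elim
    · exact ⟨j, j', h₃, h₄⟩
  obtain ⟨f, hf⟩ := exists_index Set.univ L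
    (fun i _ i' _ hi => by
      obtain ⟨j, j', h, -⟩ := hred i i' hi
      exact ⟨j, j', h⟩)
    (fun i _ i' _ => huniq _ _ _ _ (hL i' i) (hflip _ _ _ (hL i i')))
    (fun i _ i' _ i'' _ => htri _ _ _ _ _ _ (hL i i') (hL i' i'') (hL i i''))
  refine Nat.card_le_card_of_injective f fun i i' hii' => ?_
  by_contra hi
  obtain ⟨j, j', h₁, h₂⟩ := hred i i' hi
  rw [hf i trivial i' trivial hi, RainbowAtom.red.injEq] at h₁
  exact h₂ (h₁.1 ▸ h₁.2 ▸ hii')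

/-! ### Back and forth between rainbow structures with the same reds -/

/-- Partial bijections, as relations. -/
def PartialBijective {G G' : Type*} (ρ : G → G' → Prop) : Prop :=
  ∀ ⦃i i' k k'⦄, ρ i i' → ρ k k' → (i = k ↔ i' = k')

/-- Atoms of two rainbow structures with the same reds correspond if they have the same colour, and
in case of greens, have indices related by `ρ`. -/
inductive Related {G G' R : Type u} (ρ : G → G' → Prop) :
    RainbowAtom G R → RainbowAtom G' R → Prop
  | ident : Related ρ ident ident
  | black : Related ρ black black
  | white : Related ρ white white
  | yellow : Related ρ yellow yellow
  | green {i i'} (h : ρ i i') : Related ρ (green i) (green i')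
  | red (j j') : Related ρ (red j j') (red j j')

namespace Related

variable {G G' R : Type u} {ρ : G → G' → Prop} {a b c : RainbowAtom G R}
  {a' b' c' : RainbowAtom G' R}

theorem conv (h : Related ρ a a') : Related ρ a.conv a'.conv := by
  cases h <;> constructor
  assumption

theorem swap (h : Related ρ a a') : Related (fun i' i => ρ i i') a' a := by
  cases h <;> constructor
  assumption

theorem eq_iff (hρ : PartialBijective ρ) (ha : Related ρ a a') (hb : Related ρ b b') :
    a = b ↔ a' = b' := by
  cases ha <;> cases hb <;> simp
  exact hρ ‹_› ‹_›

theorem isId_iff (ha : Related ρ a a') : a = RainbowAtom.ident ↔ a' = RainbowAtom.ident := by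
  cases ha <;> simp

theorem basicForbidden_iff (hρ : PartialBijective ρ) (ha : Related ρ a a') (hb : Related ρ b b')
    (hc : Related ρ c c') : basicForbidden a b c ↔ basicForbidden a' b' c' := by
  by_cases h : a = RainbowAtom.ident
  · obtain rfl := h
    obtain rfl := ha.isId_iff.1 rfl
    exact not_congr (eq_iff hρ hb hc)
  cases ha <;> try exact (h rfl).elim
  all_goals
    cases hb <;> try exact Iff.rfl
    all_goals
      cases hc <;> try exact Iff.rfl
  -- Only green-green-red remains, the one rule in which green indices are compared.
  exact or_congr (hρ ‹_› ‹_›) Iff.rfl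

theorem consistent_iff (hρ : PartialBijective ρ) (ha : Related ρ a a') (hb : Related ρ b b')
    (hc : Related ρ c c') : Consistent a b c ↔ Consistent a' b' c' := by
  rw [RainbowAtom.consistent_iff, RainbowAtom.consistent_iff,
    basicForbidden_iff hρ ha hb hc, basicForbidden_iff hρ ha.conv hc hb,
    basicForbidden_iff hρ hc hb.conv ha, basicForbidden_iff hρ hb hc.conv ha.conv,
    basicForbidden_iff hρ hc.conv ha hb.conv, basicForbidden_iff hρ hb.conv ha.conv hc.conv]

end Related

section BackAndForth

variable {G G' R : Type u}

/-- A marked green is answered by its partner, an unmarked one by a fresh green, any other atom by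
its namesake. -/
theorem exists_related {ρ : G → G' → Prop} (hρ : PartialBijective ρ)
    (hfresh : ∃ i', ∀ i, ¬ ρ i i') (a : RainbowAtom G R) :
    ∃ b : RainbowAtom G' R,
      PartialBijective (fun i i' => ρ i i' ∨ (a = green i ∧ b = green i')) ∧
      Related (fun i i' => ρ i i' ∨ (a = green i ∧ b = green i')) a b := by
  cases a
  case green i =>
    by_cases h : ∃ i', ρ i i'
    · obtain ⟨i', hi'⟩ := h
      have : ∀ k k', ρ k k' ∨ ((green i : RainbowAtom G R) = green k ∧
          (green i' : RainbowAtom G' R) = green k') → ρ k k' := by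
        rintro k k' (h | ⟨h₁, h₂⟩)
        · exact h
        · cases h₁
          cases h₂
          exact hi'
      exact ⟨green i', fun _ _ _ _ h₁ h₂ => hρ (this _ _ h₁) (this _ _ h₂), .green (.inl hi')⟩
    · obtain ⟨i', hi'⟩ := hfresh
      refine ⟨green i', ?_, .green (.inr ⟨rfl, rfl⟩)⟩
      rintro k k' l l' (h₁ | ⟨h₁, h₂⟩) (h₃ | ⟨h₃, h₄⟩)
      · exact hρ h₁ h₃
      · cases h₃
        cases h₄
        refine iff_of_false ?_ ?_
        · rintro rfl
          exact h ⟨_, h₁⟩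
        · rintro rfl
          exact hi' _ h₁
      · cases h₁
        cases h₂
        refine iff_of_false ?_ ?_
        · rintro rfl
          exact h ⟨_, h₃⟩
        · rintro rfl
          exact hi' _ h₃
      · cases h₁
        cases h₂
        cases h₃
        cases h₄
        simp
  case ident => exact ⟨ident, by simpa using hρ, .ident⟩
  case black => exact ⟨black, by simpa using hρ, .black⟩
  case white => exact ⟨white, by simpa using hρ, .white⟩
  case yellow => exact ⟨yellow, by simpa using hρ, .yellow⟩
  case red j j' => exact ⟨red j j', by simpa using hρ, .red j j'⟩

variable {ι : Type*}

/-- The pairs of green indices that are marked in a family of pairs of atoms. -/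
def greenPairs (p : ι → Option (RainbowAtom G R × RainbowAtom G' R)) (i : G) (i' : G') : Prop :=
  ∃ n, p n = some (green i, green i')

/-- The marked pairs are corresponding atoms. -/
structure IsCorrespondence (p : ι → Option (RainbowAtom G R × RainbowAtom G' R)) : Prop where
  partialBijective : PartialBijective (greenPairs p)
  related : ∀ n a b, p n = some (a, b) → Related (greenPairs p) a b

theorem isCorrespondence_update [DecidableEq ι]
    {p : ι → Option (RainbowAtom G R × RainbowAtom G' R)} (hp : IsCorrespondence p) (n : ι)
    {a : RainbowAtom G R} {b : RainbowAtom G' R}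
    (h₁ : PartialBijective fun i i' =>
      (∃ m ≠ n, p m = some (green i, green i')) ∨ (a = green i ∧ b = green i'))
    (h₂ : Related (fun i i' =>
      (∃ m ≠ n, p m = some (green i, green i')) ∨ (a = green i ∧ b = green i')) a b) :
    IsCorrespondence (Function.update p n (some (a, b))) := by
  have h₃ : greenPairs (Function.update p n (some (a, b))) = fun i i' =>
      (∃ m ≠ n, p m = some (green i, green i')) ∨ (a = green i ∧ b = green i') := by
    ext i i'
    constructor
    · rintro ⟨m, hm⟩
      by_cases hmn : m = n
      · subst hmn
        right
        simpa using hm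
      · left
        exact ⟨m, hmn, by simpa [hmn] using hm⟩
    · rintro (⟨m, hmn, hm⟩ | ⟨rfl, rfl⟩)
      · exact ⟨m, by simpa [hmn] using hm⟩
      · exact ⟨n, by simp⟩
  refine ⟨h₃ ▸ h₁, fun m c d hm => ?_⟩
  by_cases hmn : m = n
  · subst hmn
    obtain ⟨rfl, rfl⟩ : a = c ∧ b = d := by simpa using hm
    exact h₃ ▸ h₂
  · rw [Function.update_of_ne hmn] at hm
    cases hp.related m c d hm
    -- A pebble on two greens is itself the witness that they correspond, so moving pebble `n` does
    -- no harm.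
    case green h => exact .green ⟨m, by rw [Function.update_of_ne hmn, hm]⟩
    all_goals constructor

/-- The pebble `n` being moved blocks no green, so as many greens as pebbles suffice: were all
blocked, they would inject into the pebbles other than `n`. -/
theorem exists_fresh [Finite ι] (hcard : Nat.card ι ≤ Nat.card G') (n : ι)
    (p : ι → Option (RainbowAtom G R × RainbowAtom G' R)) :
    ∃ i', ∀ i, ¬ ∃ m ≠ n, p m = some (green i, green i') := by
  by_contra! h
  choose g m hmn hm using h
  have hinj : Function.Injective m := by
    intro i k hik
    have := hm k
    rw [← hik, hm i] at this
    simp only [Option.some.injEq, Prod.mk.injEq, RainbowAtom.green.injEq] at this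
    exact this.2
  have hfin : Finite G' := Finite.of_injective m hinj
  have hsurj := hinj.bijective_of_nat_card_le hcard
  obtain ⟨i, hi⟩ := hsurj.2 n
  exact hmn i hi

theorem IsCorrespondence.swap {p : ι → Option (RainbowAtom G R × RainbowAtom G' R)}
    (hp : IsCorrespondence p) : IsCorrespondence fun n => (p n).map Prod.swap := by
  have h : greenPairs (fun n => (p n).map Prod.swap) = fun i' i => greenPairs p i i' := by
    ext i' i
    simp [greenPairs]
  refine ⟨fun i i' k k' h₁ h₂ => ?_, fun n a b hn => ?_⟩
  · rw [h] at h₁ h₂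
    exact (hp.partialBijective h₁ h₂).symm
  · rw [h]
    obtain ⟨⟨b', a'⟩, h₁, h₂⟩ := Option.map_eq_some_iff.1 hn
    cases h₂
    exact (hp.related n _ _ h₁).swap

theorem IsCorrespondence.exists_right [DecidableEq ι] [Finite ι]
    (hcard : Nat.card ι ≤ Nat.card G')
    {p : ι → Option (RainbowAtom G R × RainbowAtom G' R)} (hp : IsCorrespondence p) (n : ι)
    (a : RainbowAtom G R) :
    ∃ b, IsCorrespondence (Function.update p n (some (a, b))) := by
  obtain ⟨b, h₁, h₂⟩ := exists_related (ρ := fun i i' => ∃ m ≠ n, p m = some (green i, green i'))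
    (fun i i' k k' ⟨m, _, hm⟩ ⟨m', _, hm'⟩ => hp.partialBijective ⟨m, hm⟩ ⟨m', hm'⟩)
    (exists_fresh hcard n p) a
  exact ⟨b, isCorrespondence_update hp n h₁ h₂⟩

theorem IsCorrespondence.exists_left [DecidableEq ι] [Finite ι]
    (hcard : Nat.card ι ≤ Nat.card G)
    {p : ι → Option (RainbowAtom G R × RainbowAtom G' R)} (hp : IsCorrespondence p) (n : ι)
    (b : RainbowAtom G' R) :
    ∃ a, IsCorrespondence (Function.update p n (some (a, b))) := by
  obtain ⟨a, ha⟩ := hp.swap.exists_right hcard n b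
  refine ⟨a, ?_⟩
  convert ha.swap using 1
  ext1 m
  by_cases hmn : m = n
  · subst hmn
    simp
  · simp [hmn, Function.comp_def]

theorem IsCorrespondence.isPartialIso {k : ℕ}
    {p : Fin k → Option (RainbowAtom G R × RainbowAtom G' R)} (hp : IsCorrespondence p) :
    PebbleGame.Position.IsPartialIso (M := rainbow G R) (N := rainbow G' R) p := by
  have hρ := hp.partialBijective
  refine ⟨fun n a b h => (hp.related n a b h).isId_iff,
    fun n a b n' a' b' h h' => ⟨(hp.related n a b h).eq_iff hρ (hp.related n' a' b' h'),
      (hp.related n' a' b' h').eq_iff hρ (hp.related n a b h).conv⟩,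
    fun n a b n' a' b' n'' a'' b'' h h' h'' => ?_⟩
  exact Related.consistent_iff hρ (hp.related n a b h) (hp.related n' a' b' h')
    (hp.related n'' a'' b'' h'')

theorem isCorrespondence_none :
    IsCorrespondence fun _ : ι => (none : Option (RainbowAtom G R × RainbowAtom G' R)) :=
  ⟨fun _ _ _ _ h => by simp [greenPairs] at h, fun _ _ _ h => by simp at h⟩

theorem secondPlayerWins (k : ℕ) (R : Type u) (hG : k ≤ Nat.card G) (hG' : k ≤ Nat.card G') :
    PebbleGame.SecondPlayerWins k (rainbow G R) (rainbow G' R) := by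
  have hr : ∀ (p : Fin k → Option (RainbowAtom G R × RainbowAtom G' R)) n a, ∃ b,
      IsCorrespondence p → IsCorrespondence (Function.update p n (some (a, b))) := by
    intro p n a
    by_cases hp : IsCorrespondence p
    · obtain ⟨b, hb⟩ := hp.exists_right (by simpa) n a
      exact ⟨b, fun _ => hb⟩
    -- A default for positions that never arise, making the answer a total function of the position.
    · exact ⟨ident, fun h => (hp h).elim⟩
  have hl : ∀ (p : Fin k → Option (RainbowAtom G R × RainbowAtom G' R)) n b, ∃ a,
      IsCorrespondence p → IsCorrespondence (Function.update p n (some (a, b))) := by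
    intro p n b
    by_cases hp : IsCorrespondence p
    · obtain ⟨a, ha⟩ := hp.exists_left (by simpa) n b
      exact ⟨a, fun _ => ha⟩
    · exact ⟨ident, fun h => (hp h).elim⟩
  choose r hr using hr
  choose l hl using hl
  let pos (h : List (PebbleGame.Move k (rainbow G R) (rainbow G' R))) :
      PebbleGame.Position k (rainbow G R) (rainbow G' R) :=
    h.foldr (fun m p => Function.update p m.1
      (some (m.2.elim (fun a => (a, r p m.1 a)) fun b => (l p m.1 b, b)))) fun _ => none
  let σ : PebbleGame.Strategy k (rainbow G R) (rainbow G' R) :=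
    ⟨fun h n a => r (pos h) n a, fun h n b => l (pos h) n b⟩
  have hpos : ∀ h, σ.position h = pos h := by
    intro h
    induction h with
    | nil => rfl
    | cons m h ih =>
      obtain ⟨n, a | b⟩ := m
      · exact congrArg (fun p => Function.update p n (some (a, r (pos h) n a))) ih
      · exact congrArg (fun p => Function.update p n (some (l (pos h) n b, b))) ih
  have hcor : ∀ h, IsCorrespondence (pos h) := by
    intro h
    induction h with
    | nil => exact isCorrespondence_none
    | cons m h ih =>
      obtain ⟨n, a | b⟩ := m
      · exact hr (pos h) n a ih
      · exact hl (pos h) n b ih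
  exact ⟨σ, fun h => hpos h ▸ (hcor h).isPartialIso⟩

/-- The variables in `V` act as pebbles: quantifying over one again moves its pebble, and the
correspondence is restored as in the game. -/
theorem sat_iff {V : Finset ℕ} (hG : V.card ≤ Nat.card G) (hG' : V.card ≤ Nat.card G')
    (φ : AtomStructure.Formula) : φ.vars ⊆ V → ∀ (v : ℕ → RainbowAtom G R)
    (w : ℕ → RainbowAtom G' R), IsCorrespondence (fun x : V => some (v x, w x)) →
      (φ.Sat (rainbow G R) v ↔ φ.Sat (rainbow G' R) w) := by
  have hrel : ∀ (v : ℕ → RainbowAtom G R) (w : ℕ → RainbowAtom G' R),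
      IsCorrespondence (fun x : V => some (v x, w x)) → ∀ x ∈ V,
        Related (greenPairs fun x : V => some (v x, w x)) (v x) (w x) :=
    fun v w h x hx => h.related ⟨x, hx⟩ _ _ rfl
  have hupd : ∀ (v : ℕ → RainbowAtom G R) (w : ℕ → RainbowAtom G' R) (x : V)
      (a : RainbowAtom G R) (b : RainbowAtom G' R),
      (fun y : V => some (Function.update v x a y, Function.update w x b y)) =
        Function.update (fun y : V => some (v y, w y)) x (some (a, b)) := by
    intro v w x a b
    ext1 y
    by_cases hxy : y = x
    · subst hxy
      simp
    · have : (y : ℕ) ≠ x := fun h => hxy (Subtype.ext h)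
      simp [hxy, this]
  induction φ with
  | falsum => exact fun _ _ _ _ => Iff.rfl
  | equal x y =>
    intro hV v w h
    simp only [AtomStructure.Formula.vars, Finset.insert_subset_iff,
      Finset.singleton_subset_iff] at hV
    exact (hrel v w h x hV.1).eq_iff h.partialBijective (hrel v w h y hV.2)
  | isId x =>
    intro hV v w h
    simp only [AtomStructure.Formula.vars, Finset.singleton_subset_iff] at hV
    exact (hrel v w h x hV).isId_iff
  | conv x y =>
    intro hV v w h
    simp only [AtomStructure.Formula.vars, Finset.insert_subset_iff,
      Finset.singleton_subset_iff] at hV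
    exact (hrel v w h y hV.2).eq_iff h.partialBijective (hrel v w h x hV.1).conv
  | consistent x y z =>
    intro hV v w h
    simp only [AtomStructure.Formula.vars, Finset.insert_subset_iff,
      Finset.singleton_subset_iff] at hV
    exact (hrel v w h x hV.1).consistent_iff h.partialBijective (hrel v w h y hV.2.1)
      (hrel v w h z hV.2.2)
  | imp φ ψ ihφ ihψ =>
    intro hV v w h
    exact imp_congr (ihφ (Finset.union_subset_left hV) v w h)
      (ihψ (Finset.union_subset_right hV) v w h)
  | all x φ ih =>
    intro hV v w h
    obtain ⟨hx, hφ⟩ := Finset.insert_subset_iff.1 hV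
    constructor
    · intro hv b
      obtain ⟨a, ha⟩ := h.exists_left (by simpa) ⟨x, hx⟩ b
      exact (ih hφ _ _ ((hupd v w ⟨x, hx⟩ a b) ▸ ha)).1 (hv a)
    · intro hw a
      obtain ⟨b, hb⟩ := h.exists_right (by simpa) ⟨x, hx⟩ a
      exact (ih hφ _ _ ((hupd v w ⟨x, hx⟩ a b) ▸ hb)).2 (hw b)

end BackAndForth

end RainbowAtom

/-! ### Theories in finitely many variables and the conclusion -/

namespace AtomStructure

theorem Formula.sat_congr {M : AtomStructure.{u}} (φ : Formula) :
    ∀ v w : ℕ → M.carrier, (∀ x ∈ φ.freeVars, v x = w x) → (φ.Sat M v ↔ φ.Sat M w) := by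
  induction φ with
  | falsum => exact fun _ _ _ => Iff.rfl
  | equal x y =>
    intro v w h
    simp only [Sat, h x (by simp [freeVars]), h y (by simp [freeVars])]
  | isId x =>
    intro v w h
    simp only [Sat, h x (by simp [freeVars])]
  | conv x y =>
    intro v w h
    simp only [Sat, h x (by simp [freeVars]), h y (by simp [freeVars])]
  | consistent x y z =>
    intro v w h
    simp only [Sat, h x (by simp [freeVars]), h y (by simp [freeVars]), h z (by simp [freeVars])]
  | imp φ ψ ihφ ihψ =>
    intro v w h
    exact imp_congr (ihφ v w fun x hx => h x (Finset.mem_union_left _ hx))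
      (ihψ v w fun x hx => h x (Finset.mem_union_right _ hx))
  | all x φ ih =>
    intro v w h
    refine forall_congr' fun a => ih _ _ fun y hy => ?_
    by_cases hyx : y = x
    · subst hyx
      simp
    · simpa [hyx] using h y (Finset.mem_erase.2 ⟨hyx, hy⟩)

/-- A theory in finitely many variables does not distinguish rainbow structures with the same reds
and enough greens. -/
theorem models_rainbow {G G' R : Type u} {Θ : Set Formula} (hΘ : ∀ φ ∈ Θ, φ.IsSentence)
    {V : Finset ℕ} (hV : ∀ φ ∈ Θ, φ.vars ⊆ V) (hG : V.card ≤ Nat.card G)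
    (hG' : V.card ≤ Nat.card G') (h : (rainbow G R).Models Θ) : (rainbow G' R).Models Θ := by
  intro φ hφ w
  have hfree : φ.freeVars = ∅ := hΘ φ hφ
  -- Constant identity assignments mark no greens, so they correspond trivially.
  rw [φ.sat_congr w (fun _ => RainbowAtom.ident) (by simp [hfree])]
  refine (RainbowAtom.sat_iff hG hG' φ (hV φ hφ) (fun _ => RainbowAtom.ident) _ ?_).1 (h φ hφ _)
  refine ⟨?_, fun n a b hab => ?_⟩
  · rintro i i' k k' ⟨n, hn⟩
    simp at hn
  · obtain ⟨rfl, rfl⟩ : RainbowAtom.ident = a ∧ RainbowAtom.ident = b := by simpa using hab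
    exact .ident

end AtomStructure

theorem corollary3p3 (K : Set AtomStructure.{u})
    (hlower : AtomStructure.atCRA.{u} ⊆ K) (hupper : K ⊆ AtomStructure.atRRA.{u}) :
    (¬ ∃ Θ : Set AtomStructure.Formula, (∀ φ ∈ Θ, φ.IsSentence) ∧
        AtomStructure.UsesFinitelyManyVariables Θ ∧ AtomStructure.Defines Θ K) ∧
    (∀ (S T : Type u) [Finite S] [Finite T], 2 ≤ Nat.card S → Nat.card S < Nat.card T →
      rainbow S S ∈ K ∧ rainbow T S ∉ K ∧ rainbow T S ∈ AtomStructure.atRA.{u} ∧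
        PebbleGame.SecondPlayerWins (Nat.card S) (rainbow S S) (rainbow T S)) := by
  have hwitness : ∀ (S T : Type u) [Finite S] [Finite T], 2 ≤ Nat.card S →
      Nat.card S < Nat.card T →
      rainbow S S ∈ K ∧ rainbow T S ∉ K ∧ rainbow T S ∈ AtomStructure.atRA.{u} ∧
        PebbleGame.SecondPlayerWins (Nat.card S) (rainbow S S) (rainbow T S) := by
    intro S T _ _ hS hT
    have : Nontrivial S := Finite.one_lt_card_iff_nontrivial.1 hS
    exact ⟨hlower (RainbowAtom.rainbow_mem_atCRA S),
      fun h => hT.not_ge (RainbowAtom.card_le_of_mem_atRRA (hupper h)),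
      RainbowAtom.rainbow_mem_atRA T S, RainbowAtom.secondPlayerWins _ S le_rfl hT.le⟩
  refine ⟨?_, hwitness⟩
  rintro ⟨Θ, hsent, ⟨V, hV⟩, hdef⟩
  -- Enough greens for the variables in `V`, at least two even if `V` is empty, and one more in `T`.
  let S := ULift.{u} (Fin (V.card + 2))
  let T := ULift.{u} (Fin (V.card + 3))
  have hS : Nat.card S = V.card + 2 := by simp [S]
  have hT : Nat.card T = V.card + 3 := by simp [T]
  have : Nontrivial S := Finite.one_lt_card_iff_nontrivial.1 (by omega)
  obtain ⟨h₁, h₂, h₃, -⟩ := hwitness S T (by omega) (by omega)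
  have h₄ := (hdef _ (RainbowAtom.rainbow_mem_atRA S S) ⟨RainbowAtom.ident⟩).1 h₁
  exact h₂ ((hdef _ h₃ ⟨RainbowAtom.ident⟩).2
    (AtomStructure.models_rainbow hsent hV (by omega) (by omega) h₄))
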